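/- Fix a finite alphabet $\mathcal A$ and a countable set $\mathcal V$ of variables. Right-linear lattice (RLL) expressions are generated by $$e,f ::= X \mid ae \mid 0 \mid \top \mid e+f \mid e\cap f \mid \mu X e \mid \nu X e \qquad (X\in\mathcal V,\ a\in\mathcal A),$$ where $\mu$ and $\nu$ bind variables. An expression is closed if it has no free variables. A closed expression $e$ denotes a language $\mathcal L(e)\subseteq\mathcal A^\omega$, defined (allowing languages as constants that denote themselves) by $\mathcal L(0)=\emptyset$, $\mathcal L(\top)=\mathcal A^\omega$, $\mathcal L(ae)=\{aw : w\in\mathcal L(e)\}$, $\mathcal L(e+f)=\mathcal L(e)\cup\mathcal L(f)$, $\mathcal L(e\cap f)=\mathcal L(e)\cap\mathcal L(f)$, $\mathcal L(\mu X e(X))=\bigcap\{S\subseteq\mathcal A^\omega : \mathcal L(e(S))\subseteq S\}$ and $\mathcal L(\nu X e(X))=\bigcup\{S\subseteq\mathcal A^\omega : S\subseteq\mathcal L(e(S))\}$. The evaluation game is played by Eloise and Abelard on the positions $(w,e)$, where $w\in\mathcal A^\omega$ and $e$ is a closed expression. From $(aw,ae)$ the only move is to $(w,e)$. From $(w,\sigma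 X e(X))$ with $\sigma\in\{\mu,\nu\}$ the only move is to $(w,e(\sigma X e(X)))$. From $(w,e+f)$ Eloise, and from $(w,e\cap f)$ Abelard, moves to $(w,e)$ or to $(w,f)$. The positions $(aw,be)$ with $a\neq b$ and $(w,0)$ belong to Eloise, the positions $(w,\top)$ belong to Abelard, and these positions have no moves. A player who owns the position in which a play is stuck loses that play. An infinite play is won by Eloise if the smallest expression, with respect to the subformula order, among those that occur infinitely often in its right components is of the form $\nu X f$; otherwise it is won by Abelard. Strategies may depend on the history of the play. **Lemma (Evaluation).** Let $e$ be a closed RLL expression and $w\in\mathcal A^\omega$. Then $w\in\mathcal L(e)$ if and only if Eloise has a winning strategy from $(w,e)$ in the evaluation game. If $w\notin\mathcal L(e)$, then Abelard has a winning strategy from $(w,e)$. -/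

import Mathlib

open Filter

/-- Right-linear lattice expressions over the alphabet `A` and the set of variables `V`. -/
inductive RLL (A : Type*) (V : Type*) where
  | var (X : V) : RLL A V
  | letter (a : A) (e : RLL A V) : RLL A V
  | zero : RLL A V
  | top : RLL A V
  | add (e f : RLL A V) : RLL A V
  | inter (e f : RLL A V) : RLL A V
  | mu (X : V) (e : RLL A V) : RLL A V
  | nu (X : V) (e : RLL A V) : RLL A V

namespace RLL

variable {A V : Type*}

/-- Free variables; `mu` and `nu` are binders. -/
def free : RLL A V → Set V
  | var X => {X}
  | letter _ e => free e
  | zero => ∅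
  | top => ∅
  | add e f => free e ∪ free f
  | inter e f => free e ∪ free f
  | mu X e => free e \ {X}
  | nu X e => free e \ {X}

def Closed (e : RLL A V) : Prop := free e = ∅

/-- `e.subst X t` replaces the free occurrences of `X` in `e` by `t`. It is the usual substitution
for closed `t` (no variable can be captured), the only case that arises from closed expressions. -/
def subst [DecidableEq V] (e : RLL A V) (X : V) (t : RLL A V) : RLL A V :=
  match e with
  | var Y => if Y = X then t else var Y
  | letter a e => letter a (subst e X t)
  | zero => zero
  | top => top
  | add e f => add (subst e X t) (subst f X t)
  | inter e f => inter (subst e X t) (subst f X t)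
  | mu Y e => if Y = X then mu Y e else mu Y (subst e X t)
  | nu Y e => if Y = X then nu Y e else nu Y (subst e X t)

/-- `Subformula e f`: the expression `e` is a (not necessarily proper) subformula of `f`. -/
inductive Subformula : RLL A V → RLL A V → Prop
  | refl (e : RLL A V) : Subformula e e
  | letter {e f : RLL A V} (a : A) : Subformula e f → Subformula e (letter a f)
  | add_left {e f : RLL A V} (g : RLL A V) : Subformula e f → Subformula e (add f g)
  | add_right {e g : RLL A V} (f : RLL A V) : Subformula e g → Subformula e (add f g)
  | inter_left {e f : RLL A V} (g : RLL A V) : Subformula e f → Subformula e (inter f g)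
  | inter_right {e g : RLL A V} (f : RLL A V) : Subformula e g → Subformula e (inter f g)
  | mu {e f : RLL A V} (X : V) : Subformula e f → Subformula e (mu X f)
  | nu {e f : RLL A V} (X : V) : Subformula e f → Subformula e (nu X f)

/-- Language semantics, where `ρ` assigns to each free variable the language put in its place.
The fixed points are the intersection of the prefixed points and the union of the postfixed
points of `S ↦ L(e(S))`. -/
def sem [DecidableEq V] : RLL A V → (V → Set (Stream' A)) → Set (Stream' A)
  | var X, ρ => ρ X
  | letter a e, ρ => {u | ∃ w ∈ sem e ρ, u = Stream'.cons a w}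
  | zero, _ => ∅
  | top, _ => Set.univ
  | add e f, ρ => sem e ρ ∪ sem f ρ
  | inter e f, ρ => sem e ρ ∩ sem f ρ
  | mu X e, ρ => ⋂₀ {S | sem e (Function.update ρ X S) ⊆ S}
  | nu X e, ρ => ⋃₀ {S | S ⊆ sem e (Function.update ρ X S)}

/-- The semantics depends only on the values of the free variables. -/
theorem sem_congr [DecidableEq V] (e : RLL A V) (ρ ρ' : V → Set (Stream' A))
    (h : ∀ X ∈ free e, ρ X = ρ' X) : sem e ρ = sem e ρ' := by
  induction e generalizing ρ ρ' with
  | var X => exact h X rfl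
  | letter a e ih => simp only [sem, ih ρ ρ' h]
  | zero => rfl
  | top => rfl
  | add e f ihe ihf =>
    simp only [sem, ihe ρ ρ' (fun X hX => h X (Or.inl hX)),
      ihf ρ ρ' (fun X hX => h X (Or.inr hX))]
  | inter e f ihe ihf =>
    simp only [sem, ihe ρ ρ' (fun X hX => h X (Or.inl hX)),
      ihf ρ ρ' (fun X hX => h X (Or.inr hX))]
  | mu X e ih =>
    have key : ∀ S, sem e (Function.update ρ X S) = sem e (Function.update ρ' X S) := by
      intro S
      apply ih
      intro Y hY
      by_cases hYX : Y = X
      · subst hYX; simp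
      · simp [hYX, h Y ⟨hY, hYX⟩]
    simp only [sem, key]
  | nu X e ih =>
    have key : ∀ S, sem e (Function.update ρ X S) = sem e (Function.update ρ' X S) := by
      intro S
      apply ih
      intro Y hY
      by_cases hYX : Y = X
      · subst hYX; simp
      · simp [hYX, h Y ⟨hY, hYX⟩]
    simp only [sem, key]

/-- The language of a closed expression; by `sem_congr` the chosen assignment is irrelevant. -/
def lang [DecidableEq V] (e : RLL A V) : Set (Stream' A) := sem e (fun _ => ∅)

/-! ### The evaluation game -/

inductive Player where
  | eloise
  | abelard

/-- Positions `(w, e)` of the evaluation game. -/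
abbrev Position (A V : Type*) := Stream' A × RLL A V

/-- Abelard owns `⊤` and `∩`; Eloise owns `0`, `+` and the letter-prefixed expressions (where she
is stuck if the letters differ). Positions `(w, μ X e)` and `(w, ν X e)` have exactly one move, so
that their owner is immaterial. Variables are never reached from closed expressions. -/
def owner : Position A V → Player
  | (_, top) => Player.abelard
  | (_, inter _ _) => Player.abelard
  | _ => Player.eloise

/-- The moves of the evaluation game. -/
inductive Move [DecidableEq V] : Position A V → Position A V → Prop
  | letter (a : A) (w : Stream' A) (e : RLL A V) : Move (Stream'.cons a w, letter a e) (w, e)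
  | add_left (w : Stream' A) (e f : RLL A V) : Move (w, add e f) (w, e)
  | add_right (w : Stream' A) (e f : RLL A V) : Move (w, add e f) (w, f)
  | inter_left (w : Stream' A) (e f : RLL A V) : Move (w, inter e f) (w, e)
  | inter_right (w : Stream' A) (e f : RLL A V) : Move (w, inter e f) (w, f)
  | mu (w : Stream' A) (X : V) (e : RLL A V) : Move (w, mu X e) (w, e.subst X (mu X e))
  | nu (w : Stream' A) (X : V) (e : RLL A V) : Move (w, nu X e) (w, e.subst X (nu X e))

def Deadlock [DecidableEq V] (p : Position A V) : Prop := ¬ ∃ q, Move p q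

/-- `e` occurs infinitely often in the right component of `π`. -/
def OccursInf (π : ℕ → Position A V) (e : RLL A V) : Prop := ∃ᶠ n in atTop, (π n).2 = e

/-- `e` is the smallest (with respect to subformulas) expression that occurs infinitely often. -/
def IsCritical (π : ℕ → Position A V) (e : RLL A V) : Prop :=
  OccursInf π e ∧ ∀ f, OccursInf π f → Subformula e f

/-- Winner of an infinite play: Eloise wins if the smallest expression occurring infinitely often
is a `ν`-formula, and Abelard wins otherwise. -/
def WinsInfinite : Player → (ℕ → Position A V) → Prop
  | Player.eloise, π => ∃ X f, IsCritical π (nu X f)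
  | Player.abelard, π => ¬ ∃ X f, IsCritical π (nu X f)

/-- A (history-dependent) strategy of the player `P`: `next h p` is the move chosen at the position
`p` after the earlier positions `h`; it is legal if `P` owns `p` and has a move there. -/
structure Strategy (A V : Type*) [DecidableEq V] (P : Player) where
  next : List (Position A V) → Position A V → Position A V
  legal : ∀ h p, owner p = P → ¬ Deadlock p → Move p (next h p)

/-- The first `N` steps (all steps, if `N = ⊤`) of `π` are moves of the game and those of the player
`P` are made according to `s`. -/
def Strategy.Follows [DecidableEq V] {P : Player} (s : Strategy A V P)
    (π : ℕ → Position A V) (N : ℕ∞) : Prop :=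
  ∀ k : ℕ, (k : ℕ∞) < N → Move (π k) (π (k + 1)) ∧
    (owner (π k) = P → π (k + 1) = s.next ((List.range k).map π) (π k))

/-- The strategy `s` of the player `P` wins every play from `p`: a finite play that follows `s` and
ends in deadlock ends in a position of the opponent, and an infinite one is won by `P`. -/
def Strategy.WinsFrom [DecidableEq V] {P : Player} (s : Strategy A V P)
    (p : Position A V) : Prop :=
  (∀ (π : ℕ → Position A V) (n : ℕ), π 0 = p → s.Follows π n → Deadlock (π n) →
    owner (π n) ≠ P) ∧
  (∀ π : ℕ → Position A V, π 0 = p → s.Follows π ⊤ → WinsInfinite P π)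

def HasWinningStrategy [DecidableEq V] (P : Player) (p : Position A V) : Prop :=
  ∃ s : Strategy A V P, s.WinsFrom p

end RLL

/-! A true claim is an invariant that its defender can preserve. Let `P` be the player whose claim
is true: `w` lies in the language (Eloise) or outside it (Abelard). A position is presented as an
open expression with a stack of the fixed points unfolded so far. Those whose recurrence `P` wins
are read exactly; the others are read as ordinal approximants, with the ordinal stored in the frame.
Under this reading `P` can keep the claim true (`State.Valid.progress`), so `P` is never stuck.
Unfolding a variable discards the frames above its binder, leaves those below untouched, and
strictly lowers the ordinal of the binder if `P` loses that fixed point (`Frame.exists_reset`).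

In an infinite run the stack heights are bounded; let `d` be their limit inferior. The frame at
height `d` is eventually never removed, yet it is reset infinitely often
(`State.frequently_landing`). Ordinals do not descend forever, so this frame is of the kind that `P`
wins. Its closed fixed point occurs at every reset. It is also a subformula of every later position,
because a future reset is possible only if the current expression still refers to the frame
(`State.isCritical_of_landing`). So it is the critical expression, and `P` wins.

This gives both implications from truth to strategies. The remaining one follows because winning
strategies of both players could be played against each other (`not_both_winning`). -/

namespace RLL

open OrdinalApprox

universe u v

variable {A V : Type*}

/-! ### Fixed point expressions and heights -/

/-- The fixed point expression whose infinite recurrence is won by the given player. -/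
def fix : Player → V → RLL A V → RLL A V
  | Player.eloise => nu
  | Player.abelard => mu

/-- Makes the subformula order antisymmetric, and later bounds the stacks and the steps between two
changes of the stack. -/
def height : RLL A V → ℕ
  | var _ => 0
  | letter _ e => height e + 1
  | zero => 0
  | top => 0
  | add e f => max (height e) (height f) + 1
  | inter e f => max (height e) (height f) + 1
  | mu _ e => height e + 1
  | nu _ e => height e + 1

@[simp] theorem height_fix (σ : Player) (X : V) (f : RLL A V) :
    height (fix σ X f) = height f + 1 := by
  cases σ <;> rfl

@[simp] theorem free_fix (σ : Player) (X : V) (f : RLL A V) :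
    free (fix σ X f) = free f \ {X} := by
  cases σ <;> rfl

theorem Subformula.eq_or_height_lt {e f : RLL A V} (h : Subformula e f) :
    e = f ∨ height e < height f := by
  induction h with
  | refl => exact Or.inl rfl
  | _ => right; simp only [height]; grind

theorem Subformula.antisymm {e f : RLL A V} (h : Subformula e f) (h' : Subformula f e) :
    e = f := by
  rcases h.eq_or_height_lt with h | h
  · exact h
  · rcases h'.eq_or_height_lt with h' | h'
    · exact h'.symm
    · omega

theorem Subformula.trans {e f g : RLL A V} (h : Subformula e f) (h' : Subformula f g) :
    Subformula e g := by
  induction h' with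
  | refl => exact h
  | letter a _ ih => exact .letter a ih
  | add_left k _ ih => exact .add_left k ih
  | add_right k _ ih => exact .add_right k ih
  | inter_left k _ ih => exact .inter_left k ih
  | inter_right k _ ih => exact .inter_right k ih
  | mu X _ ih => exact .mu X ih
  | nu X _ ih => exact .nu X ih

section

variable [DecidableEq V]

/-! ### Simultaneous substitution -/

/-- Simultaneous substitution of `θ X` for the free occurrences of every variable `X`. -/
def inst : (V → RLL A V) → RLL A V → RLL A V
  | θ, var X => θ X
  | θ, letter a e => letter a (inst θ e)
  | _, zero => zero
  | _, top => top
  | θ, add e f => add (inst θ e) (inst θ f)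
  | θ, inter e f => inter (inst θ e) (inst θ f)
  | θ, mu X e => mu X (inst (Function.update θ X (var X)) e)
  | θ, nu X e => nu X (inst (Function.update θ X (var X)) e)

theorem inst_fix (θ : V → RLL A V) (σ : Player) (X : V) (f : RLL A V) :
    inst θ (fix σ X f) = fix σ X (inst (Function.update θ X (var X)) f) := by
  cases σ <;> rfl

theorem inst_eq_self (e : RLL A V) (θ : V → RLL A V) (h : ∀ X ∈ free e, θ X = var X) :
    inst θ e = e := by
  induction e generalizing θ with
  | var X => exact h X rfl
  | letter a e ih => simp only [inst, ih θ h]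
  | zero => rfl
  | top => rfl
  | add e f ihe ihf =>
    simp only [inst, ihe θ fun X hX => h X (Or.inl hX), ihf θ fun X hX => h X (Or.inr hX)]
  | inter e f ihe ihf =>
    simp only [inst, ihe θ fun X hX => h X (Or.inl hX), ihf θ fun X hX => h X (Or.inr hX)]
  | mu X e ih | nu X e ih =>
    simp only [inst]
    rw [ih]
    intro Y hY
    by_cases hYX : Y = X
    · subst hYX; simp
    · simpa [hYX] using h Y ⟨hY, hYX⟩

theorem subst_eq_self (e : RLL A V) (X : V) (t : RLL A V) (h : X ∉ free e) :
    e.subst X t = e := by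
  induction e with
  | var Y => simp only [free, Set.mem_singleton_iff] at h; simp [subst, Ne.symm h]
  | letter a e ih => simp only [subst, ih h]
  | zero => rfl
  | top => rfl
  | add e f ihe ihf =>
    simp only [free, Set.mem_union, not_or] at h; simp only [subst, ihe h.1, ihf h.2]
  | inter e f ihe ihf =>
    simp only [free, Set.mem_union, not_or] at h; simp only [subst, ihe h.1, ihf h.2]
  | mu Y e ih | nu Y e ih =>
    by_cases hYX : Y = X
    · simp [subst, hYX]
    · simp only [subst, hYX, if_false]
      rw [ih fun hX => h ⟨hX, fun h' => hYX h'.symm⟩]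

theorem free_inst_subset (e : RLL A V) (θ : V → RLL A V) :
    free (inst θ e) ⊆ ⋃ X ∈ free e, free (θ X) := by
  induction e generalizing θ with
  | var X => simp [inst, free]
  | letter a e ih => exact ih θ
  | zero => simp [inst, free]
  | top => simp [inst, free]
  | add e f ihe ihf =>
    simp only [inst, free, Set.biUnion_union]
    exact Set.union_subset_union (ihe θ) (ihf θ)
  | inter e f ihe ihf =>
    simp only [inst, free, Set.biUnion_union]
    exact Set.union_subset_union (ihe θ) (ihf θ)
  | mu X e ih | nu X e ih =>
    rintro Z ⟨hZ, hZX⟩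
    have hZ' := ih _ hZ
    simp only [Set.mem_iUnion] at hZ' ⊢
    obtain ⟨Y, hY, hZY⟩ := hZ'
    by_cases hYX : Y = X
    · subst hYX
      simp only [Function.update_self] at hZY
      exact (hZX hZY).elim
    · exact ⟨Y, ⟨hY, hYX⟩, by simpa [hYX] using hZY⟩

theorem closed_inst (e : RLL A V) {θ : V → RLL A V} (h : ∀ X, (θ X).Closed) :
    (inst θ e).Closed := by
  have h' : ∀ X, free (θ X) = ∅ := h
  have := free_inst_subset e θ
  simpa [h', Closed] using this

/-- Lets the unfolding of a closed-up fixed point be read as an update of the closing substitution,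
that is, as pushing a frame. -/
theorem subst_inst_update (f : RLL A V) (θ : V → RLL A V) (X : V) (t : RLL A V)
    (h : ∀ Y, Y ≠ X → X ∉ free (θ Y)) :
    (inst (Function.update θ X (var X)) f).subst X t = inst (Function.update θ X t) f := by
  induction f generalizing θ with
  | var Y =>
    by_cases hYX : Y = X
    · subst hYX; simp [inst, subst]
    · simp only [inst, Function.update_of_ne hYX]
      exact subst_eq_self _ _ _ (h Y hYX)
  | letter a e ih => simp only [inst, subst, ih θ h]
  | zero => rfl
  | top => rfl
  | add e f ihe ihf => simp only [inst, subst, ihe θ h, ihf θ h]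
  | inter e f ihe ihf => simp only [inst, subst, ihe θ h, ihf θ h]
  | mu Y e ih | nu Y e ih =>
    by_cases hYX : Y = X
    · subst hYX; simp [inst, subst]
    · simp only [inst, subst, hYX, if_false]
      rw [Function.update_comm (Ne.symm hYX), Function.update_comm (Ne.symm hYX), ih]
      intro Z hZ
      by_cases hZY : Z = Y
      · subst hZY; simpa [free] using Ne.symm hZ
      · simpa [hZY] using h Z hZ

theorem subformula_inst (e : RLL A V) (θ : V → RLL A V) {X : V} (h : X ∈ free e) :
    Subformula (θ X) (inst θ e) := by
  induction e generalizing θ with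
  | var Y => obtain rfl : X = Y := h; exact .refl _
  | letter a e ih => exact .letter a (ih θ h)
  | zero => exact h.elim
  | top => exact h.elim
  | add e f ihe ihf => exact h.elim (fun h => .add_left _ (ihe θ h)) fun h => .add_right _ (ihf θ h)
  | inter e f ihe ihf =>
    exact h.elim (fun h => .inter_left _ (ihe θ h)) fun h => .inter_right _ (ihf θ h)
  | mu Y e ih =>
    have := ih (Function.update θ Y (var Y)) h.1
    rw [Function.update_of_ne h.2] at this
    exact .mu Y this
  | nu Y e ih =>
    have := ih (Function.update θ Y (var Y)) h.1
    rw [Function.update_of_ne h.2] at this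
    exact .nu Y this

/-! ### Fixed points and their approximants -/

theorem sem_mono (e : RLL A V) : Monotone (sem e) := by
  induction e with
  | var X => exact fun ρ ρ' h => h X
  | letter a e ih =>
    rintro ρ ρ' h _ ⟨w, hw, rfl⟩
    exact ⟨w, ih h hw, rfl⟩
  | zero => exact fun _ _ _ => le_rfl
  | top => exact fun _ _ _ => le_rfl
  | add e f ihe ihf => exact fun ρ ρ' h => Set.union_subset_union (ihe h) (ihf h)
  | inter e f ihe ihf => exact fun ρ ρ' h => Set.inter_subset_inter (ihe h) (ihf h)
  | mu X e ih =>
    intro ρ ρ' h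
    refine Set.sInter_subset_sInter fun S hS => ?_
    exact (ih (update_le_update_iff.2 ⟨le_rfl, fun Y _ => h Y⟩)).trans hS
  | nu X e ih =>
    intro ρ ρ' h
    refine Set.sUnion_subset_sUnion fun S hS => ?_
    exact hS.trans (ih (update_le_update_iff.2 ⟨le_rfl, fun Y _ => h Y⟩))

/-- The monotone map `S ↦ L(e(S))`. -/
def semHom (e : RLL A V) (X : V) (ρ : V → Set (Stream' A)) :
    Set (Stream' A) →o Set (Stream' A) where
  toFun S := sem e (Function.update ρ X S)
  monotone' _ _ h := sem_mono e (update_le_update_iff.2 ⟨h, fun _ _ => le_rfl⟩)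

theorem sem_fix_unfold (σ : Player) (e : RLL A V) (X : V) (ρ : V → Set (Stream' A)) :
    sem e (Function.update ρ X (sem (fix σ X e) ρ)) = sem (fix σ X e) ρ := by
  cases σ
  · exact (semHom e X ρ).map_gfp
  · exact (semHom e X ρ).map_lfp

end

/-- `Claims P w S`: the statement about `w` and the language `S` that the player `P` defends. -/
def Claims : Player → Stream' A → Set (Stream' A) → Prop
  | Player.eloise, w, S => w ∈ S
  | Player.abelard, w, S => w ∉ S

theorem lfpApprox_bot_eq_iSup {L : Type u} [CompleteLattice L] (f : L →o L) (α : Ordinal.{u}) :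
    lfpApprox f ⊥ α = ⨆ β < α, f (lfpApprox f ⊥ β) := by
  rw [lfpApprox]
  exact bot_sup_eq _

theorem gfpApprox_top_eq_iInf {L : Type u} [CompleteLattice L] (f : L →o L) (α : Ordinal.{u}) :
    gfpApprox f ⊤ α = ⨅ β < α, f (gfpApprox f ⊤ β) := by
  rw [gfpApprox]
  exact top_inf_eq _

/-- The ordinal approximants of the fixed point `fix σ X e`. -/
noncomputable def approximant {A : Type u} {V : Type v} [DecidableEq V] (σ : Player) (X : V)
    (e : RLL A V) (ρ : V → Set (Stream' A)) (α : Ordinal.{u}) : Set (Stream' A) :=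
  match σ with
  | Player.eloise => gfpApprox (semHom e X ρ) ⊤ α
  | Player.abelard => lfpApprox (semHom e X ρ) ⊥ α

/-- Each approximant is a union (for `mu`) or intersection (for `nu`) over all smaller ordinals.
Membership in the union, or failure in the intersection, is therefore witnessed at one `β < α`, with
no distinction between successors and limits. -/
theorem Claims.exists_lt_approximant {A : Type u} {V : Type v} [DecidableEq V] {P σ : Player}
    (hσ : σ ≠ P) {X : V} {e : RLL A V} {ρ : V → Set (Stream' A)} {α : Ordinal.{u}}
    {w : Stream' A} (h : Claims P w (approximant σ X e ρ α)) :
    ∃ β < α, Claims P w (sem e (Function.update ρ X (approximant σ X e ρ β))) := by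
  cases P <;> cases σ <;> first | exact (hσ rfl).elim | skip
  · simp only [Claims, approximant] at h ⊢
    rw [lfpApprox_bot_eq_iSup] at h
    simp only [Set.iSup_eq_iUnion, Set.mem_iUnion, exists_prop] at h
    exact h
  · simp only [Claims, approximant] at h ⊢
    rw [gfpApprox_top_eq_iInf] at h
    simp only [Set.iInf_eq_iInter, Set.mem_iInter, not_forall, exists_prop] at h
    exact h

theorem Claims.exists_approximant {A : Type u} {V : Type v} [DecidableEq V] {P σ : Player}
    (hσ : σ ≠ P) {X : V} {e : RLL A V} {ρ : V → Set (Stream' A)}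
    {w : Stream' A} (h : Claims P w (sem (fix σ X e) ρ)) :
    ∃ α : Ordinal.{u}, Claims P w (approximant σ X e ρ α) := by
  cases P <;> cases σ <;> first | exact (hσ rfl).elim | skip
  · obtain ⟨α, hα⟩ := lfp_mem_range_lfpApprox (semHom e X ρ)
    exact ⟨α, by simp only [approximant, hα]; exact h⟩
  · obtain ⟨α, hα⟩ := gfp_mem_range_gfpApprox (semHom e X ρ)
    exact ⟨α, by simp only [approximant, hα]; exact h⟩

end RLL

namespace RLL

universe u v

variable {A : Type u} {V : Type v}

/-! ### Stacks of unfolded fixed points -/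

/-- A fixed point expression that has been unfolded, with an ordinal that bounds the number of
further unfoldings if its infinite recurrence is lost by the player under consideration. -/
structure Frame (A : Type u) (V : Type v) where
  kind : Player
  name : V
  body : RLL A V
  rank : Ordinal.{u}

namespace Frame

def expr (F : Frame A V) : RLL A V := fix F.kind F.name F.body

/-- `F'` replaces `F` when the fixed point is unfolded once more. -/
structure Reset (P : Player) (F' F : Frame A V) : Prop where
  kind_eq : F'.kind = F.kind
  name_eq : F'.name = F.name
  body_eq : F'.body = F.body
  rank_lt : F.kind ≠ P → F'.rank < F.rank

theorem Reset.expr_eq {P : Player} {F' F : Frame A V} (h : Reset P F' F) :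
    F'.expr = F.expr := by
  rw [expr, expr, h.kind_eq, h.name_eq, h.body_eq]

variable [DecidableEq V]

open Classical in
/-- The language that the bound variable of a frame stands for. -/
noncomputable def val (P : Player) (F : Frame A V) (ρ : V → Set (Stream' A)) : Set (Stream' A) :=
  if F.kind = P then sem F.expr ρ else approximant F.kind F.name F.body ρ F.rank

theorem exists_reset {P : Player} {F : Frame A V} {ρ : V → Set (Stream' A)} {w : Stream' A}
    (h : Claims P w (F.val P ρ)) :
    ∃ F', Reset P F' F ∧ Claims P w (sem F.body (Function.update ρ F.name (F'.val P ρ))) := by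
  by_cases hP : F.kind = P
  · refine ⟨F, ⟨rfl, rfl, rfl, fun h => (h hP).elim⟩, ?_⟩
    simp only [val, hP, if_true] at h ⊢
    rw [expr, sem_fix_unfold]
    exact h
  · simp only [val, hP, if_false] at h
    obtain ⟨β, hβ, h⟩ := h.exists_lt_approximant hP
    exact ⟨⟨F.kind, F.name, F.body, β⟩, ⟨rfl, rfl, rfl, fun _ => hβ⟩, by
      simpa only [val, hP, if_false] using h⟩

/-- Supplies the initial rank of a new frame: some approximant already satisfies the claim, and one
reset moves from the fixed point into its body. -/
theorem exists_rank {P σ : Player} {X : V} {e : RLL A V} {ρ : V → Set (Stream' A)}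
    {w : Stream' A} (h : Claims P w (sem (fix σ X e) ρ)) :
    ∃ α, Claims P w (sem e (Function.update ρ X (val P ⟨σ, X, e, α⟩ ρ))) := by
  obtain ⟨α, hα⟩ : ∃ α, Claims P w (val P ⟨σ, X, e, α⟩ ρ) := by
    by_cases hP : σ = P
    · exact ⟨0, by simpa only [val, hP, if_true, expr] using h⟩
    · obtain ⟨α, hα⟩ := h.exists_approximant hP
      exact ⟨α, by simpa only [val, hP, if_false] using hα⟩
  obtain ⟨⟨σ', X', e', β⟩, ⟨h₁, h₂, h₃, -⟩, h⟩ := exists_reset hα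
  dsimp only at h₁ h₂ h₃
  subst h₁ h₂ h₃
  exact ⟨β, h⟩

end Frame

section

variable [DecidableEq V]

noncomputable def stackVal (P : Player) : List (Frame A V) → V → Set (Stream' A)
  | [] => fun _ => ∅
  | F :: E => Function.update (stackVal P E) F.name (F.val P (stackVal P E))

/-- The closed expressions that the variables bound by a stack stand for. -/
def stackSubst : List (Frame A V) → V → RLL A V
  | [] => fun _ => zero
  | F :: E => Function.update (stackSubst E) F.name (inst (stackSubst E) F.expr)

theorem closed_stackSubst (E : List (Frame A V)) (X : V) : (stackSubst E X).Closed := by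
  induction E generalizing X with
  | nil => rfl
  | cons F E ih =>
    simp only [stackSubst]
    by_cases h : X = F.name
    · subst h; simpa using closed_inst _ ih
    · simpa [h] using ih X

theorem stack_of_notMem (P : Player) {E : List (Frame A V)} {X : V}
    (h : X ∉ E.map Frame.name) : stackVal P E X = ∅ ∧ stackSubst E X = zero := by
  induction E with
  | nil => exact ⟨rfl, rfl⟩
  | cons F E ih =>
    simp only [List.map_cons, List.mem_cons, not_or] at h
    simpa [stackVal, stackSubst, h.1] using ih h.2

theorem stackVal_append (P : Player) {E₁ E : List (Frame A V)} {X : V}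
    (h : X ∉ E₁.map Frame.name) : stackVal P (E₁ ++ E) X = stackVal P E X := by
  induction E₁ with
  | nil => rfl
  | cons F E ih =>
    simp only [List.map_cons, List.mem_cons, not_or] at h
    simpa [stackVal, h.1] using ih h.2

theorem stackSubst_append {E₁ E : List (Frame A V)} {X : V}
    (h : X ∉ E₁.map Frame.name) : stackSubst (E₁ ++ E) X = stackSubst E X := by
  induction E₁ with
  | nil => rfl
  | cons F E ih =>
    simp only [List.map_cons, List.mem_cons, not_or] at h
    simpa [stackSubst, h.1] using ih h.2

end

theorem exists_split_of_mem {E : List (Frame A V)} {X : V} (h : X ∈ E.map Frame.name) :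
    ∃ E₁ F E₂, E = E₁ ++ F :: E₂ ∧ F.name = X ∧ X ∉ E₁.map Frame.name := by
  induction E with
  | nil => simp at h
  | cons F E ih =>
    by_cases hX : F.name = X
    · exact ⟨[], F, E, rfl, hX, by simp⟩
    · simp only [List.map_cons, List.mem_cons] at h
      obtain ⟨E₁, F', E₂, rfl, h', h''⟩ := ih (h.resolve_left (Ne.symm hX))
      exact ⟨F :: E₁, F', E₂, rfl, h', by simp [Ne.symm hX] at h'' ⊢; exact h''⟩

/-! ### Annotated positions -/

/-- A position of the evaluation game presented as an open expression together with a stack that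
closes it. -/
structure State (A : Type u) (V : Type v) where
  word : Stream' A
  expr : RLL A V
  stack : List (Frame A V)

namespace State

/-- The moves of the evaluation game between annotated positions. -/
inductive Step (P : Player) : State A V → State A V → Prop
  | letter (a : A) (w : Stream' A) (e : RLL A V) (E : List (Frame A V)) :
    Step P ⟨Stream'.cons a w, letter a e, E⟩ ⟨w, e, E⟩
  | add_left (w : Stream' A) (e f : RLL A V) (E : List (Frame A V)) :
    Step P ⟨w, add e f, E⟩ ⟨w, e, E⟩
  | add_right (w : Stream' A) (e f : RLL A V) (E : List (Frame A V)) :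
    Step P ⟨w, add e f, E⟩ ⟨w, f, E⟩
  | inter_left (w : Stream' A) (e f : RLL A V) (E : List (Frame A V)) :
    Step P ⟨w, inter e f, E⟩ ⟨w, e, E⟩
  | inter_right (w : Stream' A) (e f : RLL A V) (E : List (Frame A V)) :
    Step P ⟨w, inter e f, E⟩ ⟨w, f, E⟩
  | fix (σ : Player) (X : V) (f : RLL A V) (α : Ordinal.{u}) (w : Stream' A)
    (E : List (Frame A V)) : Step P ⟨w, fix σ X f, E⟩ ⟨w, f, ⟨σ, X, f, α⟩ :: E⟩
  | var (w : Stream' A) (E₁ : List (Frame A V)) (F F' : Frame A V) (E : List (Frame A V))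
    (h : F.name ∉ E₁.map Frame.name) (hF : Frame.Reset P F' F) :
    Step P ⟨w, var F.name, E₁ ++ F :: E⟩ ⟨w, F.body, F' :: E⟩

variable [DecidableEq V]

def pos (q : State A V) : Position A V := (q.word, inst (stackSubst q.stack) q.expr)

/-- The invariant of the strategy. It is stronger than truth at `q.pos` alone, since it involves the
ranks. -/
def Valid (P : Player) (q : State A V) : Prop :=
  Claims P q.word (sem q.expr (stackVal P q.stack))

/-- The player `P` can keep the play within valid states. -/
def Progress (P : Player) (q : State A V) : Prop :=
  (owner q.pos = P → ∃ q', Step P q q' ∧ q'.Valid P ∧ Move q.pos q'.pos) ∧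
  (owner q.pos ≠ P → ∀ p, Move q.pos p → ∃ q', Step P q q' ∧ q'.Valid P ∧ q'.pos = p)

theorem Progress.of_unique {P : Player} {q q' : State A V} (h : Step P q q') (hv : q'.Valid P)
    (hm : ∀ p, Move q.pos p ↔ p = q'.pos) : Progress P q :=
  ⟨fun _ => ⟨q', h, hv, (hm _).2 rfl⟩, fun _ p hp => ⟨q', h, hv, ((hm p).1 hp).symm⟩⟩

theorem move_inst_fix_iff (w : Stream' A) (E : List (Frame A V)) (σ : Player) (X : V)
    (f : RLL A V) (p : Position A V) :
    Move (w, inst (stackSubst E) (RLL.fix σ X f)) p ↔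
      p = (w, inst (Function.update (stackSubst E) X (inst (stackSubst E) (RLL.fix σ X f))) f) := by
  rw [← subst_inst_update f (stackSubst E) X, inst_fix]
  · cases σ <;> simp only [RLL.fix] <;> constructor
    · rintro ⟨⟩; rfl
    · rintro rfl; exact .nu _ _ _
    · rintro ⟨⟩; rfl
    · rintro rfl; exact .mu _ _ _
  · intro Y _ h
    have := closed_stackSubst E Y
    rw [Closed] at this
    rw [this] at h
    exact h

theorem progress_fix {P σ : Player} {w : Stream' A} {X : V} {f : RLL A V}
    {E : List (Frame A V)} (h : Valid P ⟨w, RLL.fix σ X f, E⟩) :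
    Progress P ⟨w, RLL.fix σ X f, E⟩ := by
  obtain ⟨α, hα⟩ := Frame.exists_rank h
  exact .of_unique (.fix σ X f α w E) hα (move_inst_fix_iff w E σ X f)

theorem Valid.progress {P : Player} {q : State A V} (h : q.Valid P) : Progress P q := by
  obtain ⟨w, e, E⟩ := q
  cases e with
  | var X =>
    by_cases hX : X ∈ E.map Frame.name
    · obtain ⟨E₁, F, E, rfl, rfl, hF⟩ := exists_split_of_mem hX
      simp only [Valid, sem, stackVal_append P hF, stackVal, Function.update_self] at h
      obtain ⟨F', hF', hv⟩ := Frame.exists_reset h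
      refine .of_unique (.var w E₁ F F' E hF hF') ?_ ?_
      · simpa only [Valid, stackVal, hF'.name_eq] using hv
      · intro p
        simp only [pos, inst, stackSubst_append hF, stackSubst, Function.update_self,
          hF'.name_eq, hF'.expr_eq]
        exact move_inst_fix_iff w E F.kind F.name F.body p
    -- An unbound variable stands for `zero`: Eloise's claim is then false, and against Abelard she
    -- is stuck.
    · obtain ⟨h₁, h₂⟩ := stack_of_notMem P hX
      simp only [Valid, sem, h₁] at h
      cases P
      · exact h.elim
      · constructor
        · simp [pos, inst, h₂, owner]
        · simp only [pos, inst, h₂]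
          rintro _ p ⟨⟩
  | letter a e =>
    cases P
    · obtain ⟨w', hw', rfl⟩ := h
      refine .of_unique (.letter a w' e E) hw' fun p => ⟨?_, ?_⟩
      · generalize hq : pos ⟨Stream'.cons a w', letter a e, E⟩ = q
        intro hm
        cases hm <;> simp only [pos, inst, Prod.mk.injEq, reduceCtorEq, and_false] at hq
        obtain ⟨h₁, h₂⟩ := hq
        injection h₂ with h₂ h₃
        subst h₃
        simp [pos, Stream'.cons_injective2 h₁]
      · rintro rfl; exact .letter _ _ _
    · refine ⟨fun h => by simp [pos, inst, owner] at h, ?_⟩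
      rintro - p hm
      simp only [pos, inst] at hm
      cases hm with
      | letter _ w' _ => exact ⟨_, .letter a w' e E, fun hw' => h ⟨w', hw', rfl⟩, rfl⟩
  | zero =>
    cases P
    · exact h.elim
    · exact ⟨fun h => by simp [pos, inst, owner] at h, fun _ p hm => by cases hm⟩
  | top =>
    cases P
    · exact ⟨fun h => by simp [pos, inst, owner] at h, fun _ p hm => by cases hm⟩
    · exact (h trivial).elim
  | add e f =>
    cases P
    · refine ⟨fun _ => ?_, fun h => (h rfl).elim⟩
      rcases h with h | h
      · exact ⟨_, .add_left w e f E, h, .add_left _ _ _⟩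
      · exact ⟨_, .add_right w e f E, h, .add_right _ _ _⟩
    · refine ⟨fun h => by simp [pos, inst, owner] at h, ?_⟩
      rintro - p hm
      simp only [pos, inst] at hm
      cases hm with
      | add_left => exact ⟨_, .add_left w e f E, fun hw => h (Or.inl hw), rfl⟩
      | add_right => exact ⟨_, .add_right w e f E, fun hw => h (Or.inr hw), rfl⟩
  | inter e f =>
    cases P
    · refine ⟨fun h => by simp [pos, inst, owner] at h, ?_⟩
      rintro - p hm
      simp only [pos, inst] at hm
      cases hm with
      | inter_left => exact ⟨_, .inter_left w e f E, h.1, rfl⟩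
      | inter_right => exact ⟨_, .inter_right w e f E, h.2, rfl⟩
    · refine ⟨fun _ => ?_, fun h => (h rfl).elim⟩
      by_cases hw : w ∈ sem e (stackVal Player.abelard E)
      · exact ⟨_, .inter_right w e f E, fun hw' => h ⟨hw, hw'⟩, .inter_right _ _ _⟩
      · exact ⟨_, .inter_left w e f E, hw, .inter_left _ _ _⟩
  | mu X f => exact progress_fix (σ := Player.abelard) h
  | nu X f => exact progress_fix (σ := Player.eloise) h

end State

end RLL

namespace RLL

universe u v

variable {A : Type u} {V : Type v} [DecidableEq V]

/-! ### Strategies from annotated positions -/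

namespace State

open Classical in
/-- The position to which `P` moves from `q`. -/
noncomputable def reply (P : Player) (q : State A V) : Position A V :=
  if h : ∃ q', Step P q q' ∧ q'.Valid P ∧ Move q.pos q'.pos then h.choose.pos else q.pos

open Classical in
/-- The state reached from `q` when the play moves to the position `p`. -/
noncomputable def track (P : Player) (q : State A V) (p : Position A V) : State A V :=
  if h : ∃ q', Step P q q' ∧ q'.Valid P ∧ q'.pos = p then h.choose else q

theorem track_spec {P : Player} {q : State A V} {p : Position A V}
    (h : ∃ q', Step P q q' ∧ q'.Valid P ∧ q'.pos = p) :
    Step P q (track P q p) ∧ (track P q p).Valid P ∧ (track P q p).pos = p := by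
  rw [track, dif_pos h]
  exact h.choose_spec

theorem reply_spec {P : Player} {q : State A V}
    (h : ∃ q', Step P q q' ∧ q'.Valid P ∧ Move q.pos q'.pos) :
    Move q.pos (reply P q) ∧ ∃ q', Step P q q' ∧ q'.Valid P ∧ q'.pos = reply P q := by
  rw [reply, dif_pos h]
  obtain ⟨h₁, h₂, h₃⟩ := h.choose_spec
  exact ⟨h₃, _, h₁, h₂, rfl⟩

/-- The state reached from `q` by a play through the given positions, the first of which is the
position of `q`. -/
noncomputable def trackAll (P : Player) (q : State A V) (l : List (Position A V)) : State A V :=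
  l.tail.foldl (track P) q

theorem trackAll_range_succ (P : Player) (q : State A V) (π : ℕ → Position A V) (k : ℕ) :
    trackAll P q ((List.range (k + 1 + 1)).map π) =
      track P (trackAll P q ((List.range (k + 1)).map π)) (π (k + 1)) := by
  rw [List.range_succ (n := k + 1), List.map_append, trackAll,
    List.tail_append_of_ne_nil (by simp), List.foldl_append]
  rfl

open Classical in
/-- The strategy that replays the history and answers from the state it leads to. -/
noncomputable def strategy (P : Player) (q : State A V) : Strategy A V P where
  next h p :=
    -- The fallback to an arbitrary move only secures legality on histories that the strategy never
    -- produces.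
    if Move p (reply P (trackAll P q (h ++ [p]))) then reply P (trackAll P q (h ++ [p]))
    else if hp : ∃ p', Move p p' then hp.choose else p
  legal h p _ hp := by
    split_ifs with h₁ h₂
    · exact h₁
    · exact h₂.choose_spec
    · exact (hp h₂).elim

/-- Lifts a play to a run of valid annotated positions, where ranks and stacks are visible. -/
theorem exists_run {P : Player} {q₀ : State A V} (h₀ : q₀.Valid P) {π : ℕ → Position A V} {N : ℕ∞}
    (hπ : π 0 = q₀.pos) (hf : (strategy P q₀).Follows π N) :
    ∃ q : ℕ → State A V, q 0 = q₀ ∧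
      (∀ k : ℕ, (k : ℕ∞) ≤ N → (q k).pos = π k ∧ (q k).Valid P) ∧
      ∀ k : ℕ, (k : ℕ∞) < N → Step P (q k) (q (k + 1)) := by
  let q : ℕ → State A V := fun k => trackAll P q₀ ((List.range (k + 1)).map π)
  have hq : ∀ k : ℕ, (k : ℕ∞) < N → (q k).pos = π k → (q k).Valid P →
      Step P (q k) (q (k + 1)) ∧ (q (k + 1)).Valid P ∧ (q (k + 1)).pos = π (k + 1) := by
    intro k hk hp hv
    have hs : q (k + 1) = track P (q k) (π (k + 1)) := trackAll_range_succ P q₀ π k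
    rw [hs]
    apply track_spec
    obtain ⟨hm, hn⟩ := hf k hk
    obtain ⟨h₁, h₂⟩ := hv.progress
    by_cases ho : owner (q k).pos = P
    · obtain ⟨hr, hr'⟩ := reply_spec (h₁ ho)
      rw [hp] at ho
      have hl : (List.range k).map π ++ [π k] = (List.range (k + 1)).map π := by
        simp [List.range_succ]
      have hnext : (strategy P q₀).next ((List.range k).map π) (π k) = reply P (q k) := by
        simp only [strategy]
        rw [hl]
        exact if_pos (by rw [← hp]; exact hr)
      rw [hn ho, hnext]
      exact hr'
    · exact h₂ ho _ (by rw [hp]; exact hm)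
  have hq' : ∀ k : ℕ, (k : ℕ∞) ≤ N → (q k).pos = π k ∧ (q k).Valid P := by
    intro k
    induction k with
    | zero => exact fun _ => ⟨hπ.symm, h₀⟩
    | succ k ih =>
      intro hk
      have hk' : (k : ℕ∞) < N := lt_of_lt_of_le (by exact_mod_cast Nat.lt_succ_self k) hk
      obtain ⟨hp, hv⟩ := ih hk'.le
      obtain ⟨-, hv', hp'⟩ := hq k hk' hp hv
      exact ⟨hp', hv'⟩
  exact ⟨q, rfl, hq', fun k hk => (hq k hk (hq' k hk.le).1 (hq' k hk.le).2).1⟩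

theorem strategy_owner_ne {P : Player} {q₀ : State A V} (h₀ : q₀.Valid P)
    {π : ℕ → Position A V} {n : ℕ} (hπ : π 0 = q₀.pos) (hf : (strategy P q₀).Follows π n)
    (hd : Deadlock (π n)) : owner (π n) ≠ P := by
  intro ho
  obtain ⟨q, -, hq, -⟩ := exists_run h₀ hπ hf
  obtain ⟨hp, hv⟩ := hq n le_rfl
  rw [← hp] at ho hd
  obtain ⟨q', -, -, hm⟩ := hv.progress.1 ho
  exact hd ⟨_, hm⟩

end State

/-! ### The two players do not both win -/

theorem not_both_winning (p : Position A V) (he : HasWinningStrategy Player.eloise p)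
    (ha : HasWinningStrategy Player.abelard p) : False := by
  classical
  obtain ⟨s, hs₁, hs₂⟩ := he
  obtain ⟨t, ht₁, ht₂⟩ := ha
  let next : List (Position A V) → Position A V → Position A V := fun h p =>
    if owner p = Player.eloise then s.next h p else t.next h p
  -- The history is carried along because both strategies may consult it.
  let run : ℕ → List (Position A V) × Position A V := fun k =>
    (fun hp => (hp.1 ++ [hp.2], next hp.1 hp.2))^[k] ([], p)
  have hrun : ∀ k, run (k + 1) = ((run k).1 ++ [(run k).2], next (run k).1 (run k).2) :=
    fun k => Function.iterate_succ_apply' _ k _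
  let π : ℕ → Position A V := fun k => (run k).2
  have hhist : ∀ k, (run k).1 = (List.range k).map π := by
    intro k
    induction k with
    | zero => rfl
    | succ k ih => rw [hrun, ih, List.range_succ, List.map_append]; rfl
  have hπ : ∀ k, π (k + 1) = next ((List.range k).map π) (π k) := by
    intro k
    rw [← hhist]
    exact congrArg Prod.snd (hrun k)
  have howner : ∀ k, owner (π k) ≠ Player.eloise → owner (π k) = Player.abelard := by
    intro k hk
    cases h : owner (π k)
    · exact (hk h).elim
    · rfl
  have hmove : ∀ k, ¬ Deadlock (π k) → Move (π k) (π (k + 1)) := by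
    intro k hk
    rw [hπ]
    by_cases h : owner (π k) = Player.eloise
    · simp only [next, if_pos h]; exact s.legal _ _ h hk
    · simp only [next, if_neg h]; exact t.legal _ _ (howner k h) hk
  have hfs : ∀ N : ℕ∞, (∀ k : ℕ, (k : ℕ∞) < N → ¬ Deadlock (π k)) → s.Follows π N := by
    refine fun N hN k hk => ⟨hmove k (hN k hk), fun h => ?_⟩
    rw [hπ]; simp only [next, if_pos h]
  have hft : ∀ N : ℕ∞, (∀ k : ℕ, (k : ℕ∞) < N → ¬ Deadlock (π k)) → t.Follows π N := by
    refine fun N hN k hk => ⟨hmove k (hN k hk), fun h => ?_⟩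
    rw [hπ]; simp only [next, h, reduceCtorEq, if_false]
  by_cases hd : ∃ n, Deadlock (π n)
  · have hmin : ∀ k : ℕ, (k : ℕ∞) < Nat.find hd → ¬ Deadlock (π k) :=
      fun k hk => Nat.find_min hd (by exact_mod_cast hk)
    exact ht₁ π _ rfl (hft _ hmin) (Nat.find_spec hd)
      (howner _ (hs₁ π _ rfl (hfs _ hmin) (Nat.find_spec hd)))
  · push Not at hd
    exact ht₂ π rfl (hft ⊤ fun k _ => hd k) (hs₂ π rfl (hfs ⊤ fun k _ => hd k))

end RLL

namespace RLL

universe u v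

variable {A : Type u} {V : Type v}

/-! ### Dependence of variables on a frame of the stack -/

section

variable [DecidableEq V]

/-- In the stack `E`, the variable refers directly or through other frames to the variable `X`
bound right below `E`. -/
def DependsOn (X : V) : List (Frame A V) → V → Prop
  | [], Y => Y = X
  | F :: E, Y => if Y = F.name then ∃ Z ∈ free F.expr, DependsOn X E Z else DependsOn X E Y

theorem dependsOn_append {X Y : V} {E₁ E : List (Frame A V)} (h : Y ∉ E₁.map Frame.name) :
    DependsOn X (E₁ ++ E) Y ↔ DependsOn X E Y := by
  induction E₁ with
  | nil => rfl
  | cons F E₁ ih =>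
    simp only [List.map_cons, List.mem_cons, not_or] at h
    simpa [DependsOn, h.1] using ih h.2

theorem DependsOn.of_body {X : V} {F : Frame A V} {E : List (Frame A V)}
    (h : ∃ Z ∈ free F.body, DependsOn X (F :: E) Z) : ∃ Z ∈ free F.expr, DependsOn X E Z := by
  obtain ⟨Z, hZ, h⟩ := h
  rw [DependsOn] at h
  split_ifs at h with hZF
  · exact h
  · exact ⟨Z, by simpa [Frame.expr] using ⟨hZ, hZF⟩, h⟩

theorem DependsOn.subformula {F : Frame A V} {E₁ E : List (Frame A V)} {Y : V}
    (h : DependsOn F.name E₁ Y) :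
    Subformula (inst (stackSubst E) F.expr) (stackSubst (E₁ ++ F :: E) Y) := by
  induction E₁ generalizing Y with
  | nil =>
    obtain rfl : Y = F.name := h
    simpa [stackSubst] using Subformula.refl _
  | cons G E₁ ih =>
    rw [DependsOn] at h
    simp only [List.cons_append, stackSubst]
    split_ifs at h with hY
    · obtain ⟨Z, hZ, h⟩ := h
      rw [hY, Function.update_self]
      exact (ih h).trans (subformula_inst _ _ hZ)
    · rw [Function.update_of_ne hY]
      exact ih h

end

/-! ### Bounded stacks -/

/-- The frames of the stack are nested within an expression of height at most `H`. -/
def StackBounded (H : ℕ) : List (Frame A V) → Prop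
  | [] => True
  | F :: E => height F.body + (E.length + 1) ≤ H ∧ StackBounded H E

theorem StackBounded.of_append {H : ℕ} {E₁ E : List (Frame A V)}
    (h : StackBounded H (E₁ ++ E)) : StackBounded H E := by
  induction E₁ with
  | nil => exact h
  | cons F E₁ ih => exact ih h.2

namespace State

def Bounded (H : ℕ) (q : State A V) : Prop :=
  height q.expr + q.stack.length ≤ H ∧ StackBounded H q.stack

/-- A pushed frame is paid for by the lost height of the expression; a variable step returns to a
body whose bound was recorded when its frame was pushed. -/
theorem Step.bounded {P : Player} {H : ℕ} {q q' : State A V} (h : Step P q q')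
    (hq : q.Bounded H) : q'.Bounded H := by
  obtain ⟨h₁, h₂⟩ := hq
  cases h with
  | letter => refine ⟨?_, h₂⟩; simp only [height] at h₁ ⊢; omega
  | add_left => refine ⟨?_, h₂⟩; simp only [height] at h₁ ⊢; omega
  | add_right => refine ⟨?_, h₂⟩; simp only [height] at h₁ ⊢; omega
  | inter_left => refine ⟨?_, h₂⟩; simp only [height] at h₁ ⊢; omega
  | inter_right => refine ⟨?_, h₂⟩; simp only [height] at h₁ ⊢; omega
  | fix =>
    simp only [height_fix] at h₁
    refine ⟨?_, ?_, h₂⟩ <;> simp only [List.length_cons] <;> omega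
  | var w E₁ F F' E hn hF =>
    have h₃ := StackBounded.of_append h₂
    refine ⟨h₃.1, ?_, h₃.2⟩
    rw [hF.body_eq]
    exact h₃.1

/-- The step from `q` to `q'` unfolds the variable of the frame at depth `d`. -/
def Landing (d : ℕ) (q q' : State A V) : Prop :=
  (∃ X, q.expr = var X) ∧ q'.stack.length = d

/-! ### Landings at the least recurrent stack depth -/

theorem Step.stack_cases {P : Player} {q q' : State A V} (h : Step P q q') :
    (q'.stack = q.stack ∧ height q'.expr < height q.expr) ∨
      (∃ F, q'.stack = F :: q.stack) ∨ ∃ X, q.expr = RLL.var X := by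
  cases h with
  | fix => exact Or.inr (Or.inl ⟨_, rfl⟩)
  | var => exact Or.inr (Or.inr ⟨_, rfl⟩)
  | _ => refine Or.inl ⟨rfl, ?_⟩; simp only [height]; omega

/-- Without further landings at `d`, a stack higher than `d` could never return to `d`, so the depth
would eventually be constant. Then no step changes the stack and the height of the expression would
decrease forever. -/
theorem frequently_landing {P : Player} {q : ℕ → State A V} {d : ℕ}
    (hq : ∀ n, Step P (q n) (q (n + 1))) (h₁ : ∀ᶠ n in atTop, d ≤ (q n).stack.length)
    (h₂ : ∃ᶠ n in atTop, (q n).stack.length ≤ d) :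
    ∃ᶠ n in atTop, Landing d (q n) (q (n + 1)) := by
  intro h₃
  obtain ⟨N, hN⟩ := eventually_atTop.1 (h₁.and h₃)
  have hup : ∀ n ≥ N, d < (q n).stack.length → d < (q (n + 1)).stack.length := by
    intro n hn hd
    rcases (hq n).stack_cases with h | ⟨F, h⟩ | h
    · rwa [h.1]
    · rw [h, List.length_cons]; omega
    · exact lt_of_le_of_ne (hN (n + 1) (by omega)).1 fun hd => (hN n hn).2 ⟨h, hd.symm⟩
  have heq : ∀ n ≥ N, (q n).stack.length = d := by
    intro n hn
    by_contra hne
    have hlt : ∀ m ≥ n, d < (q m).stack.length := by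
      intro m hm
      induction m, hm using Nat.le_induction with
      | base => exact lt_of_le_of_ne (hN n hn).1 (Ne.symm hne)
      | succ m hm ih => exact hup m (by omega) ih
    obtain ⟨m, hm, hm'⟩ := frequently_atTop.1 h₂ n
    exact absurd (hlt m hm) (by omega)
  have hdec : ∀ k, height (q (N + k)).expr + k ≤ height (q N).expr := by
    intro k
    induction k with
    | zero => simp
    | succ k ih =>
      rcases (hq (N + k)).stack_cases with h | ⟨F, h⟩ | h
      · have := h.2
        rw [← add_assoc N k 1]
        omega
      · have h' := congrArg List.length h
        rw [List.length_cons, heq _ (by omega), heq _ (by omega)] at h'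
        omega
      · exact ((hN (N + k) (by omega)).2 ⟨h, heq _ (by omega)⟩).elim
  have := hdec (height (q N).expr + 1)
  omega

theorem Step.of_landing {P : Player} {q q' : State A V} {E₁ E : List (Frame A V)} {F : Frame A V}
    (h : Step P q q') (hs : q.stack = E₁ ++ F :: E) (hl : Landing (E.length + 1) q q') :
    q.expr = RLL.var F.name ∧ F.name ∉ E₁.map Frame.name ∧
      ∃ F', F'.Reset P F ∧ q'.stack = F' :: E := by
  obtain ⟨⟨X, hX⟩, hl⟩ := hl
  cases h with
  | var w E₁' G G' E' hn hG =>
    simp only [List.length_cons, Nat.add_right_cancel_iff] at hl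
    obtain ⟨rfl, h⟩ := List.append_inj' hs (by simp [hl])
    obtain ⟨rfl, rfl⟩ := List.cons_eq_cons.1 h
    exact ⟨rfl, hn, G', hG, rfl⟩
  | fix σ => cases σ <;> simp [RLL.fix] at hX
  | _ => simp at hX

variable [DecidableEq V]

/-- The frame `F` survives, and reference to it is inherited backwards: a step creates no reference
that was not there before. -/
theorem Step.of_not_landing {P : Player} {q q' : State A V} {E₁ E : List (Frame A V)}
    {F : Frame A V} (h : Step P q q') (hs : q.stack = E₁ ++ F :: E)
    (hd : E.length + 1 ≤ q'.stack.length) (hl : ¬ Landing (E.length + 1) q q') :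
    ∃ E₁', q'.stack = E₁' ++ F :: E ∧
      ((∃ Z ∈ free q'.expr, DependsOn F.name E₁' Z) →
        ∃ Z ∈ free q.expr, DependsOn F.name E₁ Z) := by
  cases h with
  | letter => exact ⟨E₁, hs, id⟩
  | add_left => exact ⟨E₁, hs, fun ⟨Z, hZ, h⟩ => ⟨Z, Or.inl hZ, h⟩⟩
  | add_right => exact ⟨E₁, hs, fun ⟨Z, hZ, h⟩ => ⟨Z, Or.inr hZ, h⟩⟩
  | inter_left => exact ⟨E₁, hs, fun ⟨Z, hZ, h⟩ => ⟨Z, Or.inl hZ, h⟩⟩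
  | inter_right => exact ⟨E₁, hs, fun ⟨Z, hZ, h⟩ => ⟨Z, Or.inr hZ, h⟩⟩
  | fix σ X f α w E' =>
    dsimp only at hs
    subst hs
    exact ⟨⟨σ, X, f, α⟩ :: E₁, rfl, fun h => DependsOn.of_body (F := ⟨σ, X, f, α⟩) h⟩
  | var w E₁' G G' E' hn hG =>
    have hlt : E.length < E'.length := by
      simp only [List.length_cons] at hd
      refine lt_of_le_of_ne (by omega) fun h => hl ⟨⟨_, rfl⟩, ?_⟩
      simp [h]
    dsimp only at hs
    -- Both are suffixes of the same stack, and the unfolded frame `G` lies strictly above `F`.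
    have hE : F :: E <:+ E' := by
      refine List.suffix_of_suffix_length_le (l₃ := E₁ ++ F :: E) ⟨E₁, rfl⟩ ?_ hlt
      exact ⟨E₁' ++ [G], by rw [← hs]; simp⟩
    obtain ⟨T, rfl⟩ := hE
    have hE₁ : E₁' ++ G :: T = E₁ := by
      apply List.append_cancel_right (bs := F :: E)
      rw [← hs]
      simp
    subst hE₁
    refine ⟨G' :: T, rfl, fun h => ⟨G.name, rfl, ?_⟩⟩
    rw [dependsOn_append hn, DependsOn, if_pos rfl, ← hG.expr_eq]
    refine DependsOn.of_body ?_
    rw [hG.body_eq]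
    exact h

/-! ### Infinite runs -/

theorem isCritical_of_landing {P : Player} {q : ℕ → State A V} {F₀ : Frame A V}
    {E : List (Frame A V)} (hq : ∀ n, Step P (q n) (q (n + 1)))
    (hd : ∀ n, E.length + 1 ≤ (q n).stack.length) (h₀ : (q 0).stack = F₀ :: E)
    (hl : ∃ᶠ n in atTop, Landing (E.length + 1) (q n) (q (n + 1))) :
    F₀.kind = P ∧ IsCritical (fun n => (q n).pos) (inst (stackSubst E) F₀.expr) := by
  have hex : ∀ n, ∃ E₁ F, (q n).stack = E₁ ++ F :: E := by
    intro n
    induction n with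
    | zero => exact ⟨[], F₀, h₀⟩
    | succ n ih =>
      obtain ⟨E₁, F, hs⟩ := ih
      by_cases h : Landing (E.length + 1) (q n) (q (n + 1))
      · obtain ⟨-, -, F', -, hs'⟩ := (hq n).of_landing hs h
        exact ⟨[], F', hs'⟩
      · obtain ⟨E₁', hs', -⟩ := (hq n).of_not_landing hs (hd _) h
        exact ⟨E₁', F, hs'⟩
  choose E₁ F hs using hex
  have huniq : ∀ n E₁' F', (q n).stack = E₁' ++ F' :: E → E₁' = E₁ n ∧ F' = F n := by
    intro n E₁' F' h
    rw [hs n] at h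
    obtain ⟨h₁, h₂⟩ := List.append_inj' h rfl
    exact ⟨h₁.symm, (List.cons_eq_cons.1 h₂).1.symm⟩
  have hreset : ∀ n, Landing (E.length + 1) (q n) (q (n + 1)) → (F (n + 1)).Reset P (F n) := by
    intro n h
    obtain ⟨-, -, F', hF', hs'⟩ := (hq n).of_landing (hs n) h
    rwa [← (huniq (n + 1) [] F' hs').2]
  have hkeep : ∀ n, ¬ Landing (E.length + 1) (q n) (q (n + 1)) → F (n + 1) = F n := by
    intro n h
    obtain ⟨E₁', hs', -⟩ := (hq n).of_not_landing (hs n) (hd _) h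
    exact (huniq (n + 1) E₁' (F n) hs').2.symm
  have hconst : ∀ n, (F n).kind = F₀.kind ∧ (F n).expr = F₀.expr := by
    intro n
    induction n with
    | zero => rw [← (huniq 0 [] F₀ h₀).2]; exact ⟨rfl, rfl⟩
    | succ n ih =>
      by_cases h : Landing (E.length + 1) (q n) (q (n + 1))
      · rw [(hreset n h).kind_eq, (hreset n h).expr_eq]; exact ih
      · rw [hkeep n h]; exact ih
  refine ⟨?_, ?_, ?_⟩
  · by_contra hP
    -- If the opponent won this fixed point, its rank would never increase and would drop at each of
    -- infinitely many landings.
    have hanti : Antitone fun n => (F n).rank := by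
      refine antitone_nat_of_succ_le fun n => ?_
      by_cases h : Landing (E.length + 1) (q n) (q (n + 1))
      · exact ((hreset n h).rank_lt (by rwa [(hconst n).1])).le
      · rw [hkeep n h]
    obtain ⟨_, ⟨n, rfl⟩, hmin⟩ := WellFounded.has_min (wellFounded_lt (α := Ordinal.{u}))
      (Set.range fun n => (F n).rank) ⟨_, 0, rfl⟩
    obtain ⟨m, hm, h⟩ := frequently_atTop.1 hl n
    exact hmin _ ⟨m + 1, rfl⟩
      (((hreset m h).rank_lt (by rwa [(hconst m).1])).trans_le (hanti hm))
  · refine hl.mono fun n h => ?_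
    obtain ⟨he, hn, -⟩ := (hq n).of_landing (hs n) h
    simp only [pos, he, hs n, inst]
    rw [stackSubst_append hn, stackSubst, Function.update_self, (hconst n).2]
  · have hdep : ∀ n, ∃ Z ∈ free (q n).expr, DependsOn (F n).name (E₁ n) Z := by
      -- Backward propagation from a future landing, where the expression is the variable of the
      -- frame itself.
      have key : ∀ k n, Landing (E.length + 1) (q (n + k)) (q (n + k + 1)) →
          ∃ Z ∈ free (q n).expr, DependsOn (F n).name (E₁ n) Z := by
        have base : ∀ n, Landing (E.length + 1) (q n) (q (n + 1)) →
            ∃ Z ∈ free (q n).expr, DependsOn (F n).name (E₁ n) Z := by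
          intro n h
          obtain ⟨he, hn, -⟩ := (hq n).of_landing (hs n) h
          refine ⟨(F n).name, by rw [he]; rfl, ?_⟩
          have := dependsOn_append (X := (F n).name) (E := []) hn
          rw [List.append_nil] at this
          exact this.2 rfl
        intro k
        induction k with
        | zero => exact base
        | succ k ih =>
          intro n hk
          by_cases h : Landing (E.length + 1) (q n) (q (n + 1))
          · exact base n h
          · have ih' := ih (n + 1) (by rwa [add_assoc n 1 k, add_comm 1 k])
            obtain ⟨E₁', hs', hback⟩ := (hq n).of_not_landing (hs n) (hd _) h
            rw [hkeep n h, ← (huniq (n + 1) E₁' (F n) hs').1] at ih'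
            exact hback ih'
      intro n
      obtain ⟨m, hm, h⟩ := frequently_atTop.1 hl n
      obtain ⟨k, rfl⟩ := Nat.exists_eq_add_of_le hm
      exact key k n h
    intro g hg
    obtain ⟨n, rfl⟩ := hg.exists
    obtain ⟨Z, hZ, h⟩ := hdep n
    have hsub := h.subformula (E := E)
    rw [← hs n, (hconst n).2] at hsub
    exact hsub.trans (subformula_inst _ _ hZ)

end State

/-! ### Tails of plays and the winner of an infinite run -/

theorem OccursInf.shift_iff {π : ℕ → Position A V} {k : ℕ} {e : RLL A V} :
    OccursInf (fun n => π (n + k)) e ↔ OccursInf π e := by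
  rw [OccursInf, OccursInf]
  conv_rhs => rw [← map_add_atTop_eq_nat k, frequently_map]

theorem IsCritical.of_shift {π : ℕ → Position A V} {k : ℕ} {e : RLL A V}
    (h : IsCritical (fun n => π (n + k)) e) : IsCritical π e :=
  ⟨OccursInf.shift_iff.1 h.1, fun f hf => h.2 f (OccursInf.shift_iff.2 hf)⟩

theorem IsCritical.unique {π : ℕ → Position A V} {e f : RLL A V}
    (he : IsCritical π e) (hf : IsCritical π f) : e = f :=
  (he.2 f hf.1).antisymm (hf.2 e he.1)

namespace State

variable [DecidableEq V]

theorem exists_isCritical {P : Player} {q : ℕ → State A V} {H : ℕ}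
    (hq : ∀ n, Step P (q n) (q (n + 1))) (h₀ : (q 0).Bounded H) :
    ∃ X f, IsCritical (fun n => (q n).pos) (RLL.fix P X f) := by
  have hb : ∀ n, (q n).Bounded H := by
    intro n
    induction n with
    | zero => exact h₀
    | succ n ih => exact (hq n).bounded ih
  classical
  have hex : ∃ d, ∃ᶠ n in atTop, (q n).stack.length ≤ d := by
    refine ⟨H, Eventually.frequently (.of_forall fun n => ?_)⟩
    have := (hb n).1
    omega
  obtain ⟨d, hd₁, hd₂⟩ : ∃ d, (∃ᶠ n in atTop, (q n).stack.length ≤ d) ∧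
      ∀ᶠ n in atTop, d ≤ (q n).stack.length := by
    -- The least such `d` is the limit inferior of the stack depths.
    refine ⟨Nat.find hex, Nat.find_spec hex, ?_⟩
    rcases Nat.eq_zero_or_pos (Nat.find hex) with h | h
    · simp [h]
    · have := Nat.find_min hex (Nat.sub_lt h one_pos)
      rw [not_frequently] at this
      filter_upwards [this] with n hn
      omega
  have hl := frequently_landing hq hd₂ hd₁
  obtain ⟨N, hN⟩ := eventually_atTop.1 hd₂
  obtain ⟨M, hM, hland⟩ := frequently_atTop.1 hl N
  obtain ⟨F₀, E, hE⟩ : ∃ F E, (q (M + 1)).stack = F :: E := by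
    have hstep := hq M
    obtain ⟨X, hX⟩ := hland.1
    generalize q M = r at *
    generalize q (M + 1) = r' at *
    cases hstep with
    | var w E₁ F F' E => exact ⟨F', E, rfl⟩
    | fix σ => cases σ <;> simp [RLL.fix] at hX
    | _ => simp at hX
  obtain rfl : E.length + 1 = d := by rw [← hland.2, hE]; rfl
  have hshift : ∃ᶠ n in atTop,
      Landing (E.length + 1) (q (n + (M + 1))) (q (n + (M + 1) + 1)) := by
    rw [← map_add_atTop_eq_nat (M + 1), frequently_map] at hl
    exact hl
  obtain ⟨hP, hc⟩ := isCritical_of_landing (q := fun n => q (n + (M + 1))) (P := P) (F₀ := F₀)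
    (E := E) (fun n => by have := hq (n + (M + 1)); rwa [add_right_comm] at this)
    (fun n => hN _ (by omega)) (by simpa using hE)
    (by simpa only [add_right_comm _ 1 (M + 1)] using hshift)
  rw [Frame.expr, hP, inst_fix] at hc
  exact ⟨_, _, hc.of_shift (π := fun n => (q n).pos)⟩

theorem Valid.winsFrom {P : Player} {q : State A V} (h : q.Valid P) (hs : q.stack = []) :
    (strategy P q).WinsFrom q.pos := by
  refine ⟨fun π n hπ hf => strategy_owner_ne h hπ hf, fun π hπ hf => ?_⟩
  obtain ⟨r, hr₀, hr, hstep⟩ := exists_run h hπ hf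
  have hr' : (fun n => (r n).pos) = π := funext fun n => (hr n le_top).1
  obtain ⟨X, f, hc⟩ := exists_isCritical (q := r) (P := P) (H := height q.expr)
    (fun n => hstep n (ENat.natCast_lt_top n)) (by rw [hr₀]; simp [Bounded, hs, StackBounded])
  rw [hr'] at hc
  cases P
  · exact ⟨X, f, hc⟩
  · rintro ⟨Y, g, hg⟩
    -- The critical expression is unique and is a `mu`, so it cannot also be a `nu`.
    have := hc.unique hg
    simp [RLL.fix] at this

end State

theorem hasWinningStrategy_of_claims [DecidableEq V] {P : Player} {e : RLL A V} (he : e.Closed)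
    {w : Stream' A} (h : Claims P w e.lang) : HasWinningStrategy P (w, e) := by
  have hpos : State.pos ⟨w, e, []⟩ = (w, e) := by
    simp only [State.pos]
    rw [inst_eq_self]
    intro X hX
    rw [Closed] at he
    rw [he] at hX
    exact hX.elim
  rw [← hpos]
  exact ⟨_, State.Valid.winsFrom (q := ⟨w, e, []⟩) h rfl⟩

end RLL

theorem mainTheorem2 {A V : Type*} [Finite A] [Countable V] [DecidableEq V]
    (e : RLL A V) (he : e.Closed) (w : Stream' A) :
    (w ∈ e.lang ↔ RLL.HasWinningStrategy RLL.Player.eloise (w, e)) ∧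
    (w ∉ e.lang → RLL.HasWinningStrategy RLL.Player.abelard (w, e)) := by
  have ha : w ∉ e.lang → RLL.HasWinningStrategy RLL.Player.abelard (w, e) :=
    fun h => RLL.hasWinningStrategy_of_claims he h
  refine ⟨⟨fun h => RLL.hasWinningStrategy_of_claims he h, fun h => ?_⟩, ha⟩
  by_contra hw
  exact RLL.not_both_winning _ h (ha hw)
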